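/- Let $f\ge 2$ be an integer and let $l=ef+1$ be an odd prime. Let $K$ be a field whose characteristic divides neither $f!$ nor $l$ and such that $\mathrm{Gal}(K(\zeta_l)/K)\simeq(\mathbb Z/l\mathbb Z)^\times$, where $\zeta_l$ is a primitive $l$-th root of unity. Let $\gamma$ be a generator of $(\mathbb Z/l\mathbb Z)^\times$ and put $\beta=\gamma^e$. For $m=1,\dots,e-1$ let $$h_m(x_1,\dots,x_{l-1})=\sum_{i_0+\beta i_1+\cdots+\beta^{f-1}i_{f-1}\equiv\gamma^m\ (l)}x_{i_0}x_{i_1}\cdots x_{i_{f-1}}\;-\sum_{i_0+\beta i_1+\cdots+\beta^{f-1}i_{f-1}\equiv\gamma^{m+1}\ (l)}x_{i_0}x_{i_1}\cdots x_{i_{f-1}},$$ where $i_0,\dots,i_{f-1}$ run over the residue classes modulo $l$, the subscripts of the $x_i$ are taken modulo $l$, and $x_0=0$ by convention. Let $V\subset\mathbb A^{l-1}_K=\mathrm{Spec}\,K[x_1,\dots,x_{l-1}]$ be the closed subvariety defined by $h_1=\cdots=h_{e-1}=0$. Then every $h_m$ $(1\le m\le e-1)$ is a nonzero homogeneous polynomial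 of degree $f$, and $V$ is irreducible (and stays irreducible over an algebraic closure of $K$) of dimension $l-e$. Hence $V$ is a complete intersection in $\mathbb A^{l-1}_K$ cut out by the $e-1$ $f$-ics $h_1,\dots,h_{e-1}$: its codimension is $e-1$, and $h_1,\dots,h_{e-1}$ generate the ideal of all polynomials in $K[x_1,\dots,x_{l-1}]$ that vanish on $V$. -/

import Mathlib

open MvPolynomial

namespace JacobiForms

/-- The nonzero residue classes modulo `l`: the subscripts `1, …, l - 1` of the coordinates of
affine space of dimension `l - 1`. -/
abbrev Idx (l : ℕ) : Type := {i : ZMod l // i ≠ 0}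

/-- The coordinate function `x_i`, with the subscript `i` taken modulo `l` and the convention
`x_0 = 0`. -/
noncomputable def coord (l : ℕ) (R : Type*) [CommRing R] (i : ZMod l) :
    MvPolynomial (Idx l) R :=
  if hi : i ≠ 0 then X ⟨i, hi⟩ else 0

/-- The sum of `x_{i_0} x_{i_1} ⋯ x_{i_{f-1}}` over all `(i_0, …, i_{f-1})` modulo `l` with
`i_0 + β i_1 + ⋯ + β^{f-1} i_{f-1} ≡ c` modulo `l`. -/
noncomputable def coeffSum (l : ℕ) [NeZero l] (R : Type*) [CommRing R] (f : ℕ) (β c : ZMod l) :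
    MvPolynomial (Idx l) R :=
  ∑ i : Fin f → ZMod l with ∑ k : Fin f, β ^ (k : ℕ) * i k = c, ∏ k : Fin f, coord l R (i k)

/-- The form `h_m`, the difference of the above sums for `c = γ^m` and `c = γ^{m+1}`, where
`β = γ^e`. -/
noncomputable def h (l : ℕ) [NeZero l] (R : Type*) [CommRing R] (e f : ℕ) (γ : (ZMod l)ˣ)
    (m : ℕ) : MvPolynomial (Idx l) R :=
  coeffSum l R f ((γ : ZMod l) ^ e) ((γ : ZMod l) ^ m) -
    coeffSum l R f ((γ : ZMod l) ^ e) ((γ : ZMod l) ^ (m + 1))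

/-- The family `h_1, …, h_{e-1}`. -/
noncomputable def hFamily (l : ℕ) [NeZero l] (R : Type*) [CommRing R] (e f : ℕ) (γ : (ZMod l)ˣ) :
    Fin (e - 1) → MvPolynomial (Idx l) R :=
  fun m => h l R e f γ ((m : ℕ) + 1)

/-- The closed subvariety `V` of the affine space `𝔸^{l-1}` over `F` (the prime spectrum of the
polynomial ring) defined by `h_1 = ⋯ = h_{e-1} = 0`. -/
def variety (l : ℕ) [NeZero l] (F : Type*) [Field F] (e f : ℕ) (γ : (ZMod l)ˣ) :
    Set (PrimeSpectrum (MvPolynomial (Idx l) F)) :=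
  PrimeSpectrum.zeroLocus (Set.range (hFamily l F e f γ))

/-- `Z` is a (strict) complete intersection in affine space with coordinates indexed by `σ`, cut
out by the polynomials `p_1, …, p_r`: it is their common zero locus, they generate the full ideal
of polynomials vanishing on `Z`, and the codimension of `Z` is their number `r`. -/
structure IsCompleteIntersection {σ F : Type*} [Fintype σ] [Field F] {r : ℕ}
    (Z : Set (PrimeSpectrum (MvPolynomial σ F))) (p : Fin r → MvPolynomial σ F) : Prop where
  eq_zeroLocus : Z = PrimeSpectrum.zeroLocus (Set.range p)
  vanishingIdeal_eq : PrimeSpectrum.vanishingIdeal Z = Ideal.span (Set.range p)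
  codim_eq : topologicalKrullDim Z + (r : WithBot ℕ∞) = (Fintype.card σ : WithBot ℕ∞)

end JacobiForms

/-! Over a field containing a primitive l-th root of unity, a primitive character ψ of `ZMod l`
gives linear forms y_c = ∑ ψ(ic) x_i. Those with c ≠ 0 are new coordinates: by Fourier inversion
they span all x_i, because x_0 = 0 forces ∑ y_c = 0 (`smul_coord_eq_sum`). The nonzero classes split
into e cosets of ⟨β⟩ with f elements each, and the product P_c of the y's over the coset of c is the
Fourier transform of the coefficient sums S_a (`prod_fourierCoord`).

Both S and P are invariant under multiplication by β. Modulo an ideal, all h_m vanish exactly when S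
is constant off 0, and by Fourier inversion exactly when P is. So the ideal of the h_m becomes the
ideal equating e products of f variables each, in disjoint variables (`span_hFamily_eq_map`). That
ideal is toric: it is the kernel of a monomial map into a Laurent polynomial ring, hence prime, and
merging the blocks one at a time gives a chain of primes showing that its height is at least e - 1
(`blockIdeal_eq_ker`, `le_height_blockIdeal`).

Primality and height descend from the algebraic closure by faithful flatness. Krull's height theorem
at the origin supplies the opposite bound, so the dimension is exact. A vanishing h_m would leave
too few equations for that dimension. -/

namespace JacobiForms

/-! ### Dimension, height and base change for polynomial rings. -/

section CommutativeAlgebra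

/-- The dimension of a closed subset of a prime spectrum is that of the quotient ring. -/
theorem topologicalKrullDim_zeroLocus {R : Type*} [CommRing R] (s : Set R) :
    topologicalKrullDim (PrimeSpectrum.zeroLocus s) = ringKrullDim (R ⧸ Ideal.span s) := by
  have hs : Function.Surjective (Ideal.Quotient.mk (Ideal.span s)) := Ideal.Quotient.mk_surjective
  have hemb := PrimeSpectrum.isEmbedding_comap_of_surjective _ _ hs
  have hrange : Set.range (PrimeSpectrum.comap (Ideal.Quotient.mk (Ideal.span s))) =
      PrimeSpectrum.zeroLocus s := by
    rw [range_comap_of_surjective _ _ hs, Ideal.mk_ker, PrimeSpectrum.zeroLocus_span]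
  rw [← hrange, ← PrimeSpectrum.topologicalKrullDim_eq_ringKrullDim]
  exact (IsHomeomorph.topologicalKrullDim_eq _ hemb.toHomeomorph.isHomeomorph).symm

theorem ringKrullDim_quotient_add_height_le {R : Type*} [CommRing R] (p : Ideal R) [p.IsPrime] :
    ringKrullDim (R ⧸ p) + (p.height : WithBot ℕ∞) ≤ ringKrullDim R := by
  have : Nonempty (PrimeSpectrum R) := ⟨⟨p, inferInstance⟩⟩
  have h1 : ringKrullDim (R ⧸ p) = Order.coheight (⟨p, inferInstance⟩ : PrimeSpectrum R) := by
    rw [Order.coheight_eq_krullDim_Ici, ringKrullDim_quotient]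
    congr
  rw [h1, ringKrullDim, Order.krullDim_eq_iSup_height_add_coheight_of_nonempty,
    show p.height = Order.height (⟨p, inferInstance⟩ : PrimeSpectrum R) from
      PrimeSpectrum.height_eq_orderHeight ⟨p, inferInstance⟩, add_comm]
  exact_mod_cast le_iSup (fun a : PrimeSpectrum R => Order.height a + Order.coheight a) _

variable {σ F : Type*} [Field F]

/-- The prime is the kernel of setting the variables in `s` to zero; adding one variable at a time
gives a strict chain. With all variables, this bounds the height of the ideal of the origin from
below. -/
theorem exists_isPrime_card_le_height [DecidableEq σ] (s : Finset σ) :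
    ∃ p : Ideal (MvPolynomial σ F), p.IsPrime ∧ (∀ i, X i ∈ p ↔ i ∈ s) ∧
      p ≤ RingHom.ker (constantCoeff (R := F) (σ := σ)) ∧ (s.card : ℕ∞) ≤ p.height := by
  let φ : Finset σ → (MvPolynomial σ F →ₐ[F] MvPolynomial σ F) := fun s =>
    aeval fun i => if i ∈ s then 0 else X i
  have hX : ∀ s i, X i ∈ RingHom.ker (φ s) ↔ i ∈ s := by
    intro s i
    by_cases hi : i ∈ s <;> simp [φ, RingHom.mem_ker, hi]
  refine ⟨RingHom.ker (φ s), RingHom.ker_isPrime _, hX s, ?_, ?_⟩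
  · intro q hq
    rw [RingHom.mem_ker] at hq ⊢
    have : constantCoeff.comp (φ s : MvPolynomial σ F →+* MvPolynomial σ F) = constantCoeff := by
      apply MvPolynomial.ringHom_ext
      · intro r; simp [φ]
      · intro i; by_cases hi : i ∈ s <;> simp [φ, hi]
    rw [← this, RingHom.comp_apply, RingHom.coe_coe, hq, map_zero]
  · induction s using Finset.induction_on with
    | empty => simp
    | insert a s ha ih =>
      have : (RingHom.ker (φ s)).IsPrime := RingHom.ker_isPrime _
      have : (RingHom.ker (φ (insert a s))).IsPrime := RingHom.ker_isPrime _
      have hlt : RingHom.ker (φ s) < RingHom.ker (φ (insert a s)) := by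
        refine lt_of_le_of_ne ?_ fun h => ha ((hX s a).1 (h ▸ (hX _ a).2 (by simp)))
        intro q hq
        have hcomp : (φ (insert a s)).comp (φ s) = φ (insert a s) := by
          ext i
          rcases eq_or_ne i a with rfl | hia
          · simp [φ, ha]
          · by_cases hi : i ∈ s <;> simp [φ, hi, hia]
        rw [RingHom.mem_ker] at hq ⊢
        rw [← hcomp, AlgHom.comp_apply, hq, map_zero]
      rw [Finset.card_insert_of_notMem ha]
      push_cast
      exact (add_le_add_left ih 1).trans (Ideal.height_add_one_le_of_lt_of_isPrime hlt)

/-- Polynomials without constant term: each of them lowers the dimension by at most one. -/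
theorem card_le_ringKrullDim_quotient_add_encard [Fintype σ] (s : Set (MvPolynomial σ F))
    (hs : ∀ q ∈ s, constantCoeff q = 0) :
    (Fintype.card σ : WithBot ℕ∞) ≤
      ringKrullDim (MvPolynomial σ F ⧸ Ideal.span s) + (s.encard : WithBot ℕ∞) := by
  classical
  obtain ⟨p, hp, -, hle, hcard⟩ := exists_isPrime_card_le_height (F := F) (Finset.univ : Finset σ)
  have hker : (RingHom.ker (constantCoeff (R := F) (σ := σ))).IsPrime := RingHom.ker_isPrime _
  -- Krull's height theorem at the origin, which lies on the zero locus because no constant terms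
  -- occur.
  refine le_trans ?_ (Ideal.height_le_ringKrullDim_quotient_add_encard
    (p := RingHom.ker (constantCoeff (R := F) (σ := σ))) s fun q hq => hs q hq)
  exact_mod_cast hcard.trans (Ideal.height_mono hle)

section BaseChange

variable (E : Type*) [Field E] [Algebra F E]

attribute [local instance] MvPolynomial.algebraMvPolynomial

theorem faithfullyFlat_mvPolynomial :
    Module.FaithfullyFlat (MvPolynomial σ F) (MvPolynomial σ E) :=
  Module.FaithfullyFlat.of_linearEquiv _ _
    (Algebra.IsPushout.equiv F (MvPolynomial σ F) E (MvPolynomial σ E)).symm.toLinearEquiv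

variable {E} (I : Ideal (MvPolynomial σ F))

theorem isPrime_of_isPrime_map (h : (I.map (MvPolynomial.map (σ := σ) (algebraMap F E))).IsPrime) :
    I.IsPrime := by
  have := faithfullyFlat_mvPolynomial (σ := σ) (F := F) E
  rw [← Ideal.comap_map_eq_self_of_faithfullyFlat (B := MvPolynomial σ E) I]
  exact h.comap _

/-- Flatness gives going-down, so the height upstairs is the height of `I` plus that of the extended
prime in its fibre; the latter is the zero ideal there. -/
theorem height_map_eq [Finite σ]
    (h : (I.map (MvPolynomial.map (σ := σ) (algebraMap F E))).IsPrime) :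
    (I.map (MvPolynomial.map (σ := σ) (algebraMap F E))).height = I.height := by
  have := faithfullyFlat_mvPolynomial (σ := σ) (F := F) E
  have hI := isPrime_of_isPrime_map I h
  have hc := Ideal.comap_map_eq_self_of_faithfullyFlat (B := MvPolynomial σ E) I
  have h' : (I.map (algebraMap (MvPolynomial σ F) (MvPolynomial σ E))).IsPrime := h
  have : (I.map (algebraMap (MvPolynomial σ F) (MvPolynomial σ E))).LiesOver I := ⟨hc.symm⟩
  have key := Ideal.height_eq_height_add_of_liesOver_of_hasGoingDown I
    (I.map (algebraMap (MvPolynomial σ F) (MvPolynomial σ E)))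
  rw [Ideal.map_quotient_self, Ideal.height_bot, add_zero] at key
  exact key

end BaseChange

end CommutativeAlgebra

/-! ### The toric ideal equating the products of disjoint blocks of variables. -/

section Toric

/-- The homomorphism of a polynomial ring into a group algebra induced by a homomorphism on
exponents. -/
noncomputable def monomialMap (F : Type*) [Field F] {σ N : Type*} [AddCommMonoid N]
    (φ : (σ →₀ ℕ) →+ N) : MvPolynomial σ F →ₐ[F] AddMonoidAlgebra F N :=
  AddMonoidAlgebra.mapDomainAlgHom F F φ

variable {F : Type*} [Field F]

@[simp]
theorem monomialMap_monomial {σ N : Type*} [AddCommMonoid N] (φ : (σ →₀ ℕ) →+ N)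
    (u : σ →₀ ℕ) (a : F) :
    monomialMap F φ (monomial u a) = AddMonoidAlgebra.single (φ u) a :=
  AddMonoidAlgebra.mapDomain_single

theorem monomialMap_comp {σ N N' : Type*} [AddCommMonoid N] [AddCommMonoid N']
    (φ : (σ →₀ ℕ) →+ N) (ψ : N →+ N') (q : MvPolynomial σ F) (hq : monomialMap F φ q = 0) :
    monomialMap F (ψ.comp φ) q = 0 := by
  have : monomialMap F (ψ.comp φ) =
      (AddMonoidAlgebra.mapDomainAlgHom F F ψ).comp (monomialMap F φ) := by
    apply MvPolynomial.algHom_ext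
    intro i
    simp only [AlgHom.comp_apply, X, monomialMap_monomial]
    change _ = AddMonoidAlgebra.mapDomain ψ (AddMonoidAlgebra.single _ _)
    rw [AddMonoidAlgebra.mapDomain_single]
    rfl
  rw [this, AlgHom.comp_apply, hq, map_zero]

/-- Sending `φ u` to the class of its monomial is well defined modulo `I`, so the quotient map by
`I` factors through `monomialMap F φ`. -/
theorem ker_monomialMap_le {σ N : Type*} [AddCommMonoid N] (φ : (σ →₀ ℕ) →+ N)
    (I : Ideal (MvPolynomial σ F))
    (hI : ∀ u v, φ u = φ v → monomial u (1 : F) - monomial v 1 ∈ I) :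
    RingHom.ker (monomialMap F φ) ≤ I := by
  classical
  let ψ : N → MvPolynomial σ F ⧸ I := fun n =>
    if hn : ∃ u, φ u = n then Ideal.Quotient.mk I (monomial hn.choose 1) else 0
  have hψ : ∀ u, ψ (φ u) = Ideal.Quotient.mk I (monomial u 1) := by
    intro u
    have hn : ∃ v, φ v = φ u := ⟨u, rfl⟩
    simp only [ψ, dif_pos hn]
    exact Ideal.Quotient.eq.2 (hI _ _ hn.choose_spec)
  let Ψ : AddMonoidAlgebra F N →ₗ[F] MvPolynomial σ F ⧸ I :=
    (Finsupp.linearCombination F ψ).comp (AddMonoidAlgebra.coeffLinearEquiv F).toLinearMap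
  have key : ∀ q, Ψ (monomialMap F φ q) = Ideal.Quotient.mk I q := by
    intro q
    induction q using MvPolynomial.induction_on' with
    | monomial u a =>
      have : (monomial u a : MvPolynomial σ F) = a • monomial u 1 := by
        rw [smul_monomial, smul_eq_mul, mul_one]
      rw [monomialMap_monomial]
      simp only [Ψ, LinearMap.comp_apply, LinearEquiv.coe_coe,
        AddMonoidAlgebra.coeffLinearEquiv_apply, AddMonoidAlgebra.coeff_single,
        Finsupp.linearCombination_single, hψ]
      rw [this]
      rfl
    | add p q hp hq => rw [map_add, map_add, hp, hq, map_add]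
  intro q hq
  rw [← Ideal.Quotient.eq_zero_iff_mem, ← key, (RingHom.mem_ker).1 hq, map_zero]

variable {κ ι : Type*}

/-- Exponents relative to a base point `k₀` of every block, and the sums of the exponents at the
base points of the blocks that `r` identifies. -/
def blockHom [Fintype ι] [DecidableEq ι] (k₀ : κ) (r : ι → ι) : (κ × ι →₀ ℕ) →+ (κ × ι → ℤ) × (ι → ℤ) where
  toFun u := (fun p => (u p : ℤ) - u (k₀, p.2), fun j => ∑ i with r i = j, (u (k₀, i) : ℤ))
  map_zero' := by ext <;> simp
  map_add' u v := by
    ext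
    · simp; ring
    · simp [Finset.sum_add_distrib]

/-- The exponent vector of the product of the variables of a block. -/
noncomputable def blockExp (κ : Type*) {ι : Type*} [Fintype κ] (i : ι) : κ × ι →₀ ℕ :=
  ∑ k : κ, Finsupp.single (k, i) 1

theorem blockExp_apply [Fintype κ] [DecidableEq ι] (i : ι) (p : κ × ι) : blockExp κ i p = if p.2 = i then 1 else 0 := by
  classical
  obtain ⟨k, j⟩ := p
  simp only [blockExp, Finsupp.coe_finsetSum, Finset.sum_apply, Finsupp.single_apply,
    Prod.mk.injEq]
  by_cases h : j = i
  · subst h; simp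
  · simp [h, Ne.symm h]

theorem blockHom_blockExp [Fintype κ] [Fintype ι] [DecidableEq ι] (k₀ : κ) (r : ι → ι) (i : ι) :
    blockHom k₀ r (blockExp κ i) = (0, Pi.single (r i) 1) := by
  ext j
  · simp [blockHom, blockExp_apply]
  · simp [blockHom, blockExp_apply, Pi.single_apply, eq_comm]

/-- The product of the variables of a block. -/
noncomputable def blockProd (F : Type*) [Field F] (κ : Type*) {ι : Type*} [Fintype κ] (i : ι) :
    MvPolynomial (κ × ι) F := ∏ k : κ, X (k, i)

theorem blockProd_eq_monomial [Fintype κ] (i : ι) :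
    blockProd F κ i = monomial (blockExp κ i) 1 := by
  simp only [blockProd, blockExp, X]
  rw [monomial_sum_one]

theorem blockProd_sub_mem_ker_iff [Fintype κ] [Fintype ι] [DecidableEq ι] (k₀ : κ) (r : ι → ι) (i j : ι) :
    blockProd F κ i - blockProd F κ j ∈ RingHom.ker (monomialMap F (blockHom k₀ r)) ↔
      r i = r j := by
  rw [RingHom.mem_ker, map_sub, sub_eq_zero, blockProd_eq_monomial, blockProd_eq_monomial,
    monomialMap_monomial, monomialMap_monomial, blockHom_blockExp, blockHom_blockExp]
  constructor
  · intro h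
    have h1 := AddMonoidAlgebra.single_left_injective (one_ne_zero) h
    simp only [Prod.mk.injEq, true_and] at h1
    by_contra hne
    have := congrFun h1 (r i)
    simp [hne] at this
  · intro h; rw [h]

/-- The target is the group algebra of a torsion-free abelian group, hence a domain. -/
instance isPrime_ker_monomialMap [Fintype ι] [DecidableEq ι] (k₀ : κ) (r : ι → ι) :
    (RingHom.ker (monomialMap F (blockHom k₀ r))).IsPrime :=
  RingHom.ker_isPrime _

/-- The ideal that equates the products of the variables of all blocks. -/
noncomputable def blockIdeal (F : Type*) [Field F] (κ ι : Type*) [Fintype κ] :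
    Ideal (MvPolynomial (κ × ι) F) :=
  Ideal.span (Set.range fun p : ι × ι => blockProd F κ p.1 - blockProd F κ p.2)

theorem mk_blockProd_eq [Fintype κ] (i j : ι) :
    Ideal.Quotient.mk (blockIdeal F κ ι) (blockProd F κ i) =
      Ideal.Quotient.mk (blockIdeal F κ ι) (blockProd F κ j) :=
  Ideal.Quotient.eq.2 (Ideal.subset_span ⟨(i, j), rfl⟩)

theorem mk_monomial_add_smul_blockExp [Fintype κ] [Fintype ι] (i₀ : ι) (w : κ × ι →₀ ℕ) (c : ι → ℕ) :
    Ideal.Quotient.mk (blockIdeal F κ ι) (monomial (w + ∑ i, c i • blockExp κ i) 1) =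
      Ideal.Quotient.mk (blockIdeal F κ ι) (monomial w 1) *
        Ideal.Quotient.mk (blockIdeal F κ ι) (blockProd F κ i₀) ^ ∑ i, c i := by
  have : (monomial (w + ∑ i, c i • blockExp κ i) 1 : MvPolynomial (κ × ι) F) =
      monomial w 1 * ∏ i, blockProd F κ i ^ c i := by
    simp only [blockProd_eq_monomial, monomial_pow, one_pow]
    rw [← monomial_sum_one, monomial_mul, mul_one]
  rw [this, map_mul, map_prod, ← Finset.prod_pow_eq_pow_sum]
  congr 1
  exact Finset.prod_congr rfl fun i _ => by rw [map_pow, mk_blockProd_eq i i₀]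

/-- The difference of `u` and `v` is constant on each block, and these constants sum to zero. Beyond
the common part `u ⊓ v`, both monomials are therefore products of equally many block products, which
all agree modulo the ideal. -/
theorem monomial_sub_monomial_mem_blockIdeal [Fintype κ] [Fintype ι] [DecidableEq ι] (k₀ : κ) (i₀ : ι) (u v : κ × ι →₀ ℕ)
    (h : blockHom k₀ (fun _ => i₀) u = blockHom k₀ (fun _ => i₀) v) :
    monomial u (1 : F) - monomial v 1 ∈ blockIdeal F κ ι := by
  obtain ⟨h1, h2⟩ := Prod.ext_iff.1 h
  replace h1 : ∀ p : κ × ι, (u p : ℤ) - u (k₀, p.2) = v p - v (k₀, p.2) := fun p => congrFun h1 p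
  replace h2 : ∑ i, (u (k₀, i) : ℤ) = ∑ i, (v (k₀, i) : ℤ) := by
    simpa [blockHom] using congrFun h2 i₀
  set c : ι → ℕ := fun i => u (k₀, i) - v (k₀, i) with hc
  set d : ι → ℕ := fun i => v (k₀, i) - u (k₀, i) with hd
  have hexp : ∀ (a : ι → ℕ) (p : κ × ι), (∑ i, a i • blockExp κ i) p = a p.2 := by
    intro a p
    simp [blockExp_apply]
  have hw : u = (u ⊓ v) + ∑ i, c i • blockExp κ i := by
    ext p
    rw [Finsupp.add_apply, hexp, Finsupp.inf_apply]
    have := h1 p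
    simp only [hc]
    omega
  have hw' : v = (u ⊓ v) + ∑ i, d i • blockExp κ i := by
    ext p
    rw [Finsupp.add_apply, hexp, Finsupp.inf_apply]
    have := h1 p
    simp only [hd]
    omega
  have hsum : ∑ i, c i = ∑ i, d i := by
    have h3 : ∑ i, ((c i : ℤ) - d i) = ∑ i, ((u (k₀, i) : ℤ) - v (k₀, i)) :=
      Finset.sum_congr rfl fun i _ => by simp only [hc, hd]; omega
    rw [Finset.sum_sub_distrib, Finset.sum_sub_distrib, h2, sub_self, sub_eq_zero] at h3
    exact_mod_cast h3
  rw [← Ideal.Quotient.eq]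
  conv_lhs => rw [hw]
  conv_rhs => rw [hw']
  rw [mk_monomial_add_smul_blockExp i₀, mk_monomial_add_smul_blockExp i₀, hsum]

theorem blockIdeal_eq_ker [Fintype κ] [Fintype ι] [DecidableEq ι] (k₀ : κ) (i₀ : ι) :
    blockIdeal F κ ι = RingHom.ker (monomialMap F (blockHom (ι := ι) k₀ fun _ => i₀)) := by
  refine le_antisymm ?_ (ker_monomialMap_le _ _ (monomial_sub_monomial_mem_blockIdeal k₀ i₀))
  rw [blockIdeal, Ideal.span_le]
  rintro _ ⟨p, rfl⟩
  exact (blockProd_sub_mem_ker_iff k₀ _ p.1 p.2).2 rfl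

theorem ker_monomialMap_mono [Fintype ι] [DecidableEq ι] (k₀ : κ) (r s : ι → ι) :
    RingHom.ker (monomialMap F (blockHom k₀ r)) ≤
      RingHom.ker (monomialMap F (blockHom k₀ (s ∘ r))) := by
  let push : (ι → ℤ) →+ (ι → ℤ) :=
    { toFun := fun w j => ∑ i with s i = j, w i
      map_zero' := by ext; simp
      map_add' := fun w w' => by ext; simp [Finset.sum_add_distrib] }
  have : blockHom k₀ (s ∘ r) = ((AddMonoidHom.id (κ × ι → ℤ)).prodMap push).comp
      (blockHom k₀ r) := by
    refine AddMonoidHom.ext fun u => Prod.ext rfl (funext fun j => ?_)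
    simp only [blockHom, AddMonoidHom.coe_mk, ZeroHom.coe_mk, AddMonoidHom.comp_apply,
      AddMonoidHom.coe_prodMap, Prod.map, push, Function.comp]
    rw [← Finset.sum_fiberwise_of_maps_to (t := Finset.univ.filter fun i => s i = j) (g := r)]
    · refine Finset.sum_congr rfl fun i hi => Finset.sum_congr ?_ fun _ _ => rfl
      ext x
      simp only [Finset.mem_filter, Finset.mem_univ, true_and] at hi ⊢
      exact ⟨fun hx => hx.2, fun hx => ⟨by rw [hx, hi], hx⟩⟩
    · intro i hi
      simpa using hi
  rw [this]
  exact fun q hq => monomialMap_comp _ _ q hq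

theorem isPrime_blockIdeal [Fintype κ] [Fintype ι] [Nonempty κ] [Nonempty ι] : (blockIdeal F κ ι).IsPrime := by
  classical
  rw [blockIdeal_eq_ker (Classical.arbitrary κ) (Classical.arbitrary ι)]
  infer_instance

/-- The map `r m` merges blocks 0, …, m. Each further merge enlarges the prime kernel strictly,
since it newly equates the products of blocks 0 and m + 1. -/
theorem le_height_blockIdeal [Fintype κ] [Nonempty κ] (n : ℕ) :
    (n : ℕ∞) ≤ (blockIdeal F κ (Fin (n + 1))).height := by
  obtain ⟨k₀⟩ := ‹Nonempty κ›
  let r : ℕ → Fin (n + 1) → Fin (n + 1) := fun m i => if (i : ℕ) ≤ m then 0 else i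
  have key : ∀ m ≤ n, (m : ℕ∞) ≤
      (RingHom.ker (monomialMap F (blockHom k₀ (r m)))).height := by
    intro m
    induction m with
    | zero => simp
    | succ m ih =>
      intro hm
      have hr : r (m + 1) = r (m + 1) ∘ r m := by
        funext i
        simp only [r, Function.comp]
        split_ifs <;> first | rfl | omega
      have hle := ker_monomialMap_mono (F := F) k₀ (r m) (r (m + 1))
      rw [← hr] at hle
      have hlt := lt_of_le_of_ne hle fun h => by
        have h1 := (blockProd_sub_mem_ker_iff (F := F) k₀ (r (m + 1)) 0 ⟨m + 1, by omega⟩).2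
          (by simp [r])
        rw [← h, blockProd_sub_mem_ker_iff] at h1
        simp [r, Fin.ext_iff] at h1
      push_cast
      exact (add_le_add_left (ih (by omega)) 1).trans
        (Ideal.height_add_one_le_of_lt_of_isPrime hlt)
  have hr : r n = fun _ => 0 := by
    funext i
    simp [r, Nat.lt_succ_iff.1 i.2]
  rw [blockIdeal_eq_ker k₀ 0, ← hr]
  exact key n le_rfl

end Toric

/-! ### Fourier coordinates and the passage from the forms to block products. -/

section Fourier

variable {l : ℕ} [Fact l.Prime] {F : Type*} [Field F] {ψ : AddChar (ZMod l) F}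

theorem sum_char_mul_of_ne_zero (hψ : ψ.IsPrimitive) {b : ZMod l} (hb : b ≠ 0) :
    ∑ x : ZMod l, ψ (x * b) = 0 := by
  rw [AddChar.sum_mulShift b hψ, if_neg hb]; simp

/-- A Fourier transform of a function that is constant off zero is constant off zero. -/
theorem fourier_eq_of_const (hψ : ψ.IsPrimitive) {Q : Type*} [CommRing Q] [Algebra F Q]
    (S P : ZMod l → Q) (t : F) (hP : ∀ c, t • P c = ∑ a, ψ (a * c) • S a)
    (hS : ∀ a, a ≠ 0 → S a = S 1) (c : ZMod l) (hc : c ≠ 0) : t • P c = S 0 - S 1 := by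
  have h0 : ∑ a, ψ (a * c) • S a = ∑ a, (ψ (a * c) • S 1 + if a = 0 then S 0 - S 1 else 0) := by
    refine Finset.sum_congr rfl fun a _ => ?_
    rcases eq_or_ne a 0 with rfl | ha
    · simp
    · simp [ha, hS a ha]
  rw [hP, h0, Finset.sum_add_distrib, ← Finset.sum_smul, sum_char_mul_of_ne_zero hψ hc]
  simp

theorem sum_idx {M : Type*} [AddCommMonoid M] (g : ZMod l → M) (hg : g 0 = 0) :
    ∑ a : Idx l, g a = ∑ a, g a := by
  rw [← Finset.sum_subtype (Finset.univ.erase (0 : ZMod l)) (fun a => by simp) g]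
  exact Finset.sum_erase _ hg

/-- Fourier inversion. -/
theorem fourier_inversion (hψ : ψ.IsPrimitive) {Q : Type*} [CommRing Q] [Algebra F Q]
    (S P : ZMod l → Q) (hP : ∀ c, P c = ∑ a, ψ (a * c) • S a) (a : ZMod l) :
    (l : F) • S a = ∑ c, ψ (c * -a) • P c := by
  simp only [hP, Finset.smul_sum, smul_smul]
  rw [Finset.sum_comm]
  have : ∀ b, ∑ c, (ψ (c * -a) * ψ (b * c)) • S b = if b = a then (l : F) • S a else 0 := by
    intro b
    have h1 : ∀ c, ψ (c * -a) * ψ (b * c) = ψ (c * (b - a)) := fun c => by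
      rw [← AddChar.map_add_eq_mul]; congr 1; ring
    simp only [h1, ← Finset.sum_smul]
    split_ifs with h
    · subst h; simp [ZMod.card]
    · rw [sum_char_mul_of_ne_zero hψ (sub_ne_zero.2 h), zero_smul]
  simp only [this, Finset.sum_ite_eq', Finset.mem_univ, if_true]

/-- The linear form `∑ ψ(i c) x_i`. -/
noncomputable def fourierCoord (ψ : AddChar (ZMod l) F) (c : ZMod l) : MvPolynomial (Idx l) F :=
  ∑ i : ZMod l, ψ (i * c) • coord l F i

theorem coord_zero : coord l F 0 = 0 := by simp [coord]

theorem coord_of_ne {l : ℕ} (F : Type*) [Field F] (i : Idx l) : coord l F i = X i := by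
  simp [coord, i.2]

theorem sum_fourierCoord (hψ : ψ.IsPrimitive) :
    ∑ c, fourierCoord ψ c = 0 := by
  have := fourier_inversion hψ (coord l F) (fourierCoord ψ) (fun _ => rfl) 0
  simpa [coord_zero] using this.symm

theorem smul_coord_eq_sum (hψ : ψ.IsPrimitive) (i : ZMod l) :
    (l : F) • coord l F i = ∑ c : Idx l, (ψ (c.1 * -i) - 1) • fourierCoord ψ c.1 := by
  have h1 := fourier_inversion hψ (coord l F) (fourierCoord ψ) (fun _ => rfl) i
  have h2 : (l : F) • coord l F i = ∑ c, (ψ (c * -i) - 1) • fourierCoord ψ c := by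
    simp only [sub_smul, one_smul, Finset.sum_sub_distrib, sum_fourierCoord hψ, sub_zero, h1]
  rw [h2, ← sum_idx _ (by simp)]

variable {e f : ℕ}

theorem prod_fourierCoord (β c : ZMod l) :
    ∏ k : Fin f, fourierCoord ψ (c * β ^ (k : ℕ)) = ∑ a, ψ (a * c) • coeffSum l F f β a := by
  simp only [fourierCoord]
  rw [Finset.prod_univ_sum, Fintype.piFinset_univ, ← Finset.sum_fiberwise (s := Finset.univ)
    (g := fun i : Fin f → ZMod l => ∑ k : Fin f, β ^ (k : ℕ) * i k)]
  refine Finset.sum_congr rfl fun a _ => ?_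
  rw [coeffSum, Finset.smul_sum]
  refine Finset.sum_congr rfl fun i hi => ?_
  rw [Finset.prod_smul]
  congr 1
  rw [← (Finset.mem_filter.1 hi).2, Finset.sum_mul, show ∀ g : Fin f → ZMod l,
    ψ (∑ k, g k) = ∏ k, ψ (g k) from
      fun g => map_prod ψ.toMonoidHom (fun k => Multiplicative.ofAdd (g k)) _]
  refine Finset.prod_congr rfl fun k _ => ?_
  congr 1
  ring

/-- Multiplication by β shifts the factors cyclically, wrapping around because `β ^ f = 1`. -/
theorem prod_fourierCoord_mul [NeZero f] {β : ZMod l} (hβ : β ^ f = 1) (c : ZMod l) :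
    ∏ k : Fin f, fourierCoord ψ (c * β * β ^ (k : ℕ)) =
      ∏ k : Fin f, fourierCoord ψ (c * β ^ (k : ℕ)) := by
  refine Fintype.prod_equiv (Equiv.addRight (1 : Fin f)) _ _ fun k => ?_
  congr 1
  have hmod : ∀ n : ℕ, β ^ (n % f) = β ^ n := fun n => by
    conv_rhs => rw [← Nat.mod_add_div n f, pow_add, pow_mul, hβ, one_pow, mul_one]
  rw [Equiv.coe_addRight, Fin.val_add, hmod, pow_add, Fin.val_one', hmod, pow_one]
  ring

/-- The invariance of the products passes to the coefficient sums by Fourier inversion, as l is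
invertible. -/
theorem coeffSum_mul [NeZero f] (hψ : ψ.IsPrimitive) (hlF : (l : F) ≠ 0) {β : ZMod l}
    (hβ : β ^ f = 1) (a : ZMod l) : coeffSum l F f β (a * β) = coeffSum l F f β a := by
  have hβ0 : β ≠ 0 := by
    rintro rfl
    rw [zero_pow (NeZero.ne f)] at hβ
    exact zero_ne_one hβ
  have hinv := fourier_inversion hψ (coeffSum l F f β)
    (fun c => ∏ k : Fin f, fourierCoord ψ (c * β ^ (k : ℕ))) (prod_fourierCoord β)
  apply smul_right_injective _ hlF
  simp only [hinv]
  refine Fintype.sum_equiv (Equiv.mulRight₀ β hβ0) _ _ fun c => ?_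
  rw [Equiv.mulRight₀_apply, prod_fourierCoord_mul hβ, mul_neg, mul_neg, mul_right_comm, mul_assoc]

section Generator

variable {γ : (ZMod l)ˣ}

theorem exists_pow_eq (hγ : Subgroup.zpowers γ = ⊤) {c : ZMod l} (hc : c ≠ 0) :
    ∃ n < l - 1, c = (γ : ZMod l) ^ n := by
  have hmem : Units.mk0 c hc ∈ Submonoid.powers γ := by
    rw [mem_powers_iff_mem_zpowers, hγ]
    trivial
  obtain ⟨n, hn⟩ := hmem
  have horder : orderOf γ = l - 1 := by
    rw [orderOf_eq_card_of_zpowers_eq_top hγ, Nat.card_eq_fintype_card, ZMod.card_units]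
  refine ⟨n % (l - 1), Nat.mod_lt _ (by have := (Fact.out : l.Prime).two_le; omega), ?_⟩
  rw [← horder, ← Units.val_pow_eq_pow_val, pow_mod_orderOf]
  exact (congrArg Units.val hn).symm

theorem exists_lt_eq_of_invariant (hγ : Subgroup.zpowers γ = ⊤) (he : 0 < e) {α : Type*}
    (g : ZMod l → α) (hg : ∀ a, g (a * (γ : ZMod l) ^ e) = g a) {c : ZMod l} (hc : c ≠ 0) :
    ∃ r < e, g c = g ((γ : ZMod l) ^ r) := by
  obtain ⟨n, -, rfl⟩ := exists_pow_eq hγ hc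
  refine ⟨n % e, Nat.mod_lt _ he, ?_⟩
  have : ∀ q r, g ((γ : ZMod l) ^ (r + e * q)) = g ((γ : ZMod l) ^ r) := by
    intro q r
    induction q with
    | zero => simp
    | succ q ih => rw [mul_add, mul_one, ← add_assoc, pow_add, hg, ih]
  conv_lhs => rw [← Nat.mod_add_div n e]
  exact this _ _

theorem pow_pow_eq_one (hlef : l = e * f + 1) : ((γ : ZMod l) ^ e) ^ f = 1 := by
  rw [← pow_mul, show e * f = l - 1 by omega]
  exact ZMod.pow_card_sub_one_eq_one γ.ne_zero

/-- The linear substitution under which the forms become differences of products of variables. -/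
noncomputable def fourierHom (ψ : AddChar (ZMod l) F) (e f : ℕ) (γ : (ZMod l)ˣ) :
    MvPolynomial (Fin f × Fin e) F →ₐ[F] MvPolynomial (Idx l) F :=
  aeval fun p => fourierCoord ψ ((γ : ZMod l) ^ (p.2 : ℕ) * ((γ : ZMod l) ^ e) ^ (p.1 : ℕ))

theorem fourierHom_surjective (hψ : ψ.IsPrimitive) (hlF : (l : F) ≠ 0) (hlef : l = e * f + 1)
    (hγ : Subgroup.zpowers γ = ⊤) : Function.Surjective (fourierHom ψ e f γ) := by
  have hY : ∀ c : Idx l, fourierCoord ψ c.1 ∈ (fourierHom ψ e f γ).range := by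
    rintro ⟨c, hc⟩
    obtain ⟨n, hn, rfl⟩ := exists_pow_eq hγ hc
    replace hn : n < e * f := by omega
    have he : 0 < e := Nat.pos_of_ne_zero (by rintro rfl; simp at hn)
    refine ⟨X (⟨n / e, Nat.div_lt_of_lt_mul hn⟩, ⟨n % e, Nat.mod_lt _ he⟩), ?_⟩
    simp only [fourierHom, AlgHom.toRingHom_eq_coe, RingHom.coe_coe, aeval_X]
    rw [← pow_mul, ← pow_add, Nat.mod_add_div]
  rw [← AlgHom.range_eq_top, eq_top_iff, ← adjoin_range_X, Algebra.adjoin_le_iff]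
  rintro _ ⟨i, rfl⟩
  have h1 : (l : F) • (X i : MvPolynomial (Idx l) F) ∈ (fourierHom ψ e f γ).range := by
    rw [← coord_of_ne, smul_coord_eq_sum hψ]
    exact Subalgebra.sum_mem _ fun c _ => Subalgebra.smul_mem _ (hY c) _
  simpa [smul_smul, inv_mul_cancel₀ hlF] using Subalgebra.smul_mem _ h1 (l : F)⁻¹

theorem fourierHom_blockProd (i : Fin e) :
    fourierHom ψ e f γ (blockProd F (Fin f) i) =
      ∏ k : Fin f, fourierCoord ψ ((γ : ZMod l) ^ (i : ℕ) * ((γ : ZMod l) ^ e) ^ (k : ℕ)) := by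
  simp [blockProd, fourierHom]

theorem span_hFamily_eq_map (hψ : ψ.IsPrimitive) (hlF : (l : F) ≠ 0) (hf : f ≠ 0)
    (hlef : l = e * f + 1) (hγ : Subgroup.zpowers γ = ⊤) :
    Ideal.span (Set.range (hFamily l F e f γ)) =
      (blockIdeal F (Fin f) (Fin e)).map (fourierHom ψ e f γ) := by
  have : NeZero f := ⟨hf⟩
  have he : 0 < e := Nat.pos_of_ne_zero fun h0 => (Fact.out : l.Prime).one_lt.ne'
    (by rw [hlef, h0, zero_mul])
  have hβ := pow_pow_eq_one (γ := γ) hlef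
  set β := (γ : ZMod l) ^ e with hβdef
  set S := coeffSum l F f β with hS
  set P : ZMod l → MvPolynomial (Idx l) F :=
    fun c => ∏ k : Fin f, fourierCoord ψ (c * β ^ (k : ℕ)) with hP
  have hPS : ∀ c, P c = ∑ a, ψ (a * c) • S a := prod_fourierCoord β
  have hSP := fourier_inversion hψ S P hPS
  have hPβ : ∀ c, P (c * β) = P c := prod_fourierCoord_mul hβ
  have hSβ : ∀ a, S (a * β) = S a := coeffSum_mul hψ hlF hβ
  apply le_antisymm
  · rw [Ideal.span_le]
    rintro _ ⟨m, rfl⟩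
    set J := (blockIdeal F (Fin f) (Fin e)).map (fourierHom ψ e f γ) with hJ
    let π := Ideal.Quotient.mkₐ F J
    have hconst : ∀ c, c ≠ 0 → π (P c) = π (P 1) := by
      intro c hc
      obtain ⟨r, hr, hcr⟩ := exists_lt_eq_of_invariant hγ he P hPβ hc
      rw [hcr, ← pow_zero (γ : ZMod l)]
      refine Ideal.Quotient.eq.2 ?_
      have : fourierHom ψ e f γ (blockProd F (Fin f) ⟨r, hr⟩ - blockProd F (Fin f) ⟨0, he⟩) ∈ J :=
        Ideal.mem_map_of_mem _ (Ideal.subset_span (Set.mem_range_self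
          ((⟨r, hr⟩ : Fin e), (⟨0, he⟩ : Fin e))))
      rwa [map_sub, fourierHom_blockProd, fourierHom_blockProd] at this
    have hl' : ∀ a : ZMod l, a ≠ 0 → (l : F) • π (S a) = π (P 0) - π (P 1) := by
      intro a ha
      -- Inversion expresses l times the reflected function a ↦ S(-a) as the transform of P, whence
      -- the signs and the factor l.
      have := fourier_eq_of_const hψ (fun c => π (P c)) (fun c => π (S (-c))) (l : F)
        (fun c => by
          rw [← map_smul, hSP, map_sum]
          simp only [neg_neg, map_smul]) hconst (-a) (neg_ne_zero.2 ha)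
      simpa only [neg_neg] using this
    refine Ideal.Quotient.eq.1 ?_
    change π (S _) = π (S _)
    apply smul_right_injective _ hlF
    simp only [hl' _ (pow_ne_zero _ γ.ne_zero)]
  · rw [blockIdeal, Ideal.map_span, Ideal.span_le]
    rintro _ ⟨_, ⟨⟨i, j⟩, rfl⟩, rfl⟩
    set J := Ideal.span (Set.range (hFamily l F e f γ)) with hJ
    let π := Ideal.Quotient.mkₐ F J
    have hstep : ∀ m, m + 1 ≤ e → π (S ((γ : ZMod l) ^ (m + 1))) = π (S (γ : ZMod l)) := by
      intro m
      induction m with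
      | zero => simp
      | succ m ih =>
        intro hm
        rw [← ih (by omega)]
        have : hFamily l F e f γ ⟨m, by omega⟩ ∈ J := Ideal.subset_span (Set.mem_range_self _)
        exact (Ideal.Quotient.eq.2 this).symm
    have hγ1 : ∀ a, a ≠ 0 → π (S a) = π (S (γ : ZMod l)) := by
      intro a ha
      obtain ⟨r, hr, har⟩ := exists_lt_eq_of_invariant hγ he S hSβ ha
      rw [har]
      -- The relations link only γ, γ², …, γ^e; the class of γ⁰ is reached from γ^e = β by
      -- β-invariance. This is why e - 1 forms suffice.
      rcases r with _ | r
      · have h1 := hstep (e - 1) (by omega)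
        rw [Nat.sub_add_cancel he, ← hβdef, ← one_mul β, hSβ] at h1
        rw [pow_zero, h1]
      · exact hstep r (by omega)
    have hconst : ∀ c, c ≠ 0 → (1 : F) • π (P c) = π (S 0) - π (S 1) :=
      fourier_eq_of_const hψ (fun a => π (S a)) (fun c => π (P c)) 1
        (fun c => by
          rw [one_smul, hPS, map_sum]
          simp only [map_smul])
        (fun a ha => by rw [hγ1 a ha, hγ1 1 one_ne_zero])
    rw [map_sub, fourierHom_blockProd, fourierHom_blockProd]
    refine Ideal.Quotient.eq.1 ?_
    change π (P _) = π (P _)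
    rw [← one_smul F (π (P _)), hconst _ (pow_ne_zero _ γ.ne_zero),
      ← one_smul F (π (P ((γ : ZMod l) ^ (j : ℕ)))), hconst _ (pow_ne_zero _ γ.ne_zero)]

end Generator

end Fourier

/-! ### Primality, dimension and nonvanishing over an arbitrary base field. -/

theorem injective_of_surjective_of_card_eq {σ τ F : Type*} [Fintype σ] [Fintype τ] [Field F]
    (hcard : Fintype.card σ = Fintype.card τ) (φ : MvPolynomial σ F →ₐ[F] MvPolynomial τ F)
    (hφ : Function.Surjective φ) : Function.Injective φ := by
  have hp : (RingHom.ker φ).IsPrime := RingHom.ker_isPrime _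
  -- The quotient by the kernel already has full dimension, so this prime has height zero and
  -- vanishes in a domain.
  have h := ringKrullDim_quotient_add_height_le (RingHom.ker φ)
  rw [ringKrullDim_eq_of_ringEquiv (Ideal.quotientKerAlgEquivOfSurjective hφ).toRingEquiv,
    MvPolynomial.ringKrullDim_of_isNoetherianRing, MvPolynomial.ringKrullDim_of_isNoetherianRing,
    ringKrullDim_eq_zero_of_field, Nat.card_eq_fintype_card, Nat.card_eq_fintype_card, hcard,
    zero_add] at h
  rw [RingHom.injective_iff_ker_eq_bot]
  change RingHom.ker φ = ⊥
  rw [← Ideal.height_eq_zero_iff_eq_bot]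
  generalize (RingHom.ker φ).height = n at h
  have h' : ((Fintype.card τ : ℕ∞) + n) ≤ Fintype.card τ := by exact_mod_cast h
  have h0 : n ≤ 0 :=
    (ENat.add_le_add_iff_left (ENat.natCast_ne_top _)).1 (h'.trans_eq (add_zero _).symm)
  exact nonpos_iff_eq_zero.1 h0

theorem card_idx (l : ℕ) [Fact l.Prime] : Fintype.card (Idx l) = l - 1 := by
  rw [Fintype.card_subtype_compl, ZMod.card]
  simp

section

variable {l e f : ℕ} [Fact l.Prime] {F : Type*} [Field F] {γ : (ZMod l)ˣ}

theorem isPrime_and_le_height_of_isPrimitive {ψ : AddChar (ZMod l) F} (hψ : ψ.IsPrimitive)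
    (hlF : (l : F) ≠ 0) (hf : f ≠ 0) (hlef : l = e * f + 1) (hγ : Subgroup.zpowers γ = ⊤) :
    (Ideal.span (Set.range (hFamily l F e f γ))).IsPrime ∧
      ((e - 1 : ℕ) : ℕ∞) ≤ (Ideal.span (Set.range (hFamily l F e f γ))).height := by
  obtain ⟨n, rfl⟩ : ∃ n, e = n + 1 := Nat.exists_eq_succ_of_ne_zero fun h0 =>
    (Fact.out : l.Prime).one_lt.ne' (by rw [hlef, h0, zero_mul])
  have : NeZero f := ⟨hf⟩
  have hsurj := fourierHom_surjective (e := n + 1) hψ hlF hlef hγ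
  have hinj := injective_of_surjective_of_card_eq
    (by rw [card_idx, Fintype.card_prod, Fintype.card_fin, Fintype.card_fin, mul_comm]; omega)
    _ hsurj
  have hprime : (blockIdeal F (Fin f) (Fin (n + 1))).IsPrime := isPrime_blockIdeal
  let φ := (AlgEquiv.ofBijective _ ⟨hinj, hsurj⟩).toRingEquiv
  have hmap : Ideal.span (Set.range (hFamily l F (n + 1) f γ)) =
      (blockIdeal F (Fin f) (Fin (n + 1))).map φ := span_hFamily_eq_map hψ hlF hf hlef hγ
  rw [hmap]
  refine ⟨Ideal.map_isPrime_of_equiv φ, ?_⟩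
  rw [RingEquiv.height_map]
  exact le_height_blockIdeal n

theorem exists_isPrimitive_addChar [IsAlgClosed F] (hlF : (l : F) ≠ 0) :
    ∃ ψ : AddChar (ZMod l) F, ψ.IsPrimitive := by
  have : NeZero (l : F) := ⟨hlF⟩
  obtain ⟨ζ, hζ⟩ := HasEnoughRootsOfUnity.exists_primitiveRoot F l
  exact ⟨_, AddChar.zmodChar_primitive_of_primitive_root l hζ⟩

theorem map_hFamily {E : Type*} [Field E] (g : F →+* E) (m : Fin (e - 1)) :
    MvPolynomial.map g (hFamily l F e f γ m) = hFamily l E e f γ m := by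
  have hcoord : ∀ i, MvPolynomial.map g (coord l F i) = coord l E i := by
    intro i
    unfold coord
    split_ifs <;> simp
  simp [hFamily, h, coeffSum, hcoord, map_prod]

theorem map_span_hFamily {E : Type*} [Field E] (g : F →+* E) :
    (Ideal.span (Set.range (hFamily l F e f γ))).map (MvPolynomial.map g) =
      Ideal.span (Set.range (hFamily l E e f γ)) := by
  rw [Ideal.map_span, ← Set.range_comp]
  congr 2
  funext m
  exact map_hFamily g m

/-- The algebraic closure contains the roots of unity needed for the Fourier coordinates; the forms
are defined over the prime ring, so both properties descend. -/
theorem isPrime_and_le_height (hlF : (l : F) ≠ 0) (hf : f ≠ 0) (hlef : l = e * f + 1)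
    (hγ : Subgroup.zpowers γ = ⊤) :
    (Ideal.span (Set.range (hFamily l F e f γ))).IsPrime ∧
      ((e - 1 : ℕ) : ℕ∞) ≤ (Ideal.span (Set.range (hFamily l F e f γ))).height := by
  have hlE : (l : AlgebraicClosure F) ≠ 0 := by
    rw [← map_natCast (algebraMap F (AlgebraicClosure F))]
    exact (map_ne_zero _).2 hlF
  obtain ⟨ψ, hψ⟩ := exists_isPrimitive_addChar hlE
  obtain ⟨h1, h2⟩ := isPrime_and_le_height_of_isPrimitive hψ hlE hf hlef hγ
  rw [← map_span_hFamily (algebraMap F (AlgebraicClosure F))] at h1 h2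
  exact ⟨isPrime_of_isPrime_map _ h1, height_map_eq _ h1 ▸ h2⟩

theorem isHomogeneous_h (m : ℕ) : (h l F e f γ m).IsHomogeneous f := by
  have hcoord : ∀ i, (coord l F i).IsHomogeneous 1 := by
    intro i
    unfold coord
    split_ifs
    · exact isHomogeneous_X _ _
    · exact isHomogeneous_zero _ _ _
  have hS : ∀ β c, (coeffSum l F f β c).IsHomogeneous f := by
    intro β c
    refine IsHomogeneous.sum _ _ _ fun i _ => ?_
    simpa using IsHomogeneous.prod Finset.univ (fun k : Fin f => coord l F (i k)) (fun _ => 1)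
      fun k _ => hcoord _
  exact (hS _ _).sub (hS _ _)

theorem constantCoeff_h (hf : f ≠ 0) (m : ℕ) : constantCoeff (h l F e f γ m) = 0 := by
  by_contra hne
  have := isHomogeneous_h (l := l) (F := F) (e := e) (f := f) (γ := γ) m hne
  rw [map_zero] at this
  exact hf this.symm

theorem ringKrullDim_quotient_span_hFamily (hlF : (l : F) ≠ 0) (hf : f ≠ 0)
    (hlef : l = e * f + 1) (hγ : Subgroup.zpowers γ = ⊤) :
    ringKrullDim (MvPolynomial (Idx l) F ⧸ Ideal.span (Set.range (hFamily l F e f γ))) +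
      ((e - 1 : ℕ) : WithBot ℕ∞) = ((l - 1 : ℕ) : WithBot ℕ∞) := by
  obtain ⟨hprime, hht⟩ := isPrime_and_le_height (F := F) hlF hf hlef hγ
  apply le_antisymm
  · have h1 := ringKrullDim_quotient_add_height_le
      (Ideal.span (Set.range (hFamily l F e f γ)))
    rw [MvPolynomial.ringKrullDim_of_isNoetherianRing, ringKrullDim_eq_zero_of_field, zero_add,
      Nat.card_eq_fintype_card, card_idx] at h1
    refine le_trans ?_ h1
    gcongr
    exact WithBot.coe_le_coe.2 hht
  · have h1 := card_le_ringKrullDim_quotient_add_encard (Set.range (hFamily l F e f γ))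
      (by rintro _ ⟨m, rfl⟩; exact constantCoeff_h hf _)
    rw [card_idx] at h1
    refine h1.trans ?_
    gcongr
    have : (Set.range (hFamily l F e f γ)).encard ≤ ((e - 1 : ℕ) : ℕ∞) := by
      rw [← Set.image_univ]
      refine (Set.encard_image_le _ _).trans ?_
      simp
    exact WithBot.coe_le_coe.2 this

theorem natCast_eq_of_add_eq {d : WithBot ℕ∞} {a b : ℕ} (h : d + (a : WithBot ℕ∞) = (b : ℕ)) :
    d = ((b - a : ℕ) : WithBot ℕ∞) := by
  induction d with
  | bot => simp at h
  | coe d =>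
    have h' : d + (a : ℕ∞) = (b : ℕ) := by exact_mod_cast h
    cases d with
    | top => simp at h'
    | coe d =>
      have h'' : d + a = b := by exact_mod_cast h'
      have : d = b - a := by omega
      rw [this]
      rfl

/-- If one form vanished, the other e - 2 would generate the same ideal, and Krull's bound would
exceed the known dimension. -/
theorem h_ne_zero (hlF : (l : F) ≠ 0) (hf : f ≠ 0) (hlef : l = e * f + 1)
    (hγ : Subgroup.zpowers γ = ⊤) {m : ℕ} (hm : 1 ≤ m) (hme : m ≤ e - 1) :
    h l F e f γ m ≠ 0 := by
  intro h0
  have hdim := natCast_eq_of_add_eq (ringKrullDim_quotient_span_hFamily (F := F) hlF hf hlef hγ)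
  let i : Fin (e - 1) := ⟨m - 1, by omega⟩
  have hi : hFamily l F e f γ i = 0 := by
    simpa only [hFamily, i, Nat.sub_add_cancel hm] using h0
  set s := hFamily l F e f γ '' {i}ᶜ with hs
  have hspan : Ideal.span s = Ideal.span (Set.range (hFamily l F e f γ)) := by
    refine le_antisymm (Ideal.span_mono (Set.image_subset_range _ _)) ?_
    rw [Ideal.span_le]
    rintro _ ⟨j, rfl⟩
    rcases eq_or_ne j i with rfl | hj
    · rw [hi]; exact zero_mem _
    · exact Ideal.subset_span ⟨j, hj, rfl⟩
  have h1 := card_le_ringKrullDim_quotient_add_encard s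
    (by rintro _ ⟨j, -, rfl⟩; exact constantCoeff_h hf _)
  have hcard : s.encard ≤ ((e - 2 : ℕ) : ℕ∞) := by
    refine (Set.encard_image_le _ _).trans ?_
    rw [Set.encard_eq_coe_toFinset_card]
    have : ({i}ᶜ : Set (Fin (e - 1))).toFinset.card = e - 2 := by
      rw [Set.toFinset_compl, Set.toFinset_singleton, Finset.card_compl, Fintype.card_fin,
        Finset.card_singleton]
      omega
    rw [this]
  rw [hspan, hdim, card_idx] at h1
  have h2 : ((l - 1 : ℕ) : ℕ∞) ≤ ((l - 1 - (e - 1) : ℕ) : ℕ∞) + ((e - 2 : ℕ) : ℕ∞) := by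
    refine le_trans ?_ (add_le_add_right hcard _)
    exact WithBot.coe_le_coe.1 h1
  have h3 : l - 1 ≤ l - 1 - (e - 1) + (e - 2) := by exact_mod_cast h2
  -- Guarantees e ≤ l - 1, so the truncated subtraction in `h3` is a genuine one.
  have h4 : e * 1 ≤ e * f := Nat.mul_le_mul_left e (Nat.one_le_iff_ne_zero.2 hf)
  omega

theorem isIrreducible_variety (hlF : (l : F) ≠ 0) (hf : f ≠ 0) (hlef : l = e * f + 1)
    (hγ : Subgroup.zpowers γ = ⊤) : IsIrreducible (variety l F e f γ) := by
  have hp := (isPrime_and_le_height (F := F) hlF hf hlef hγ).1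
  rw [variety, ← PrimeSpectrum.zeroLocus_span]
  exact (PrimeSpectrum.isIrreducible_zeroLocus_iff_of_radical _ hp.isRadical).2 hp

end

end JacobiForms

theorem corollary1p7 (l e f : ℕ) [Fact l.Prime] (hl : Odd l) (hf : 2 ≤ f) (hlef : l = e * f + 1)
    (K : Type*) [Field K]
    (hcharf : ¬ ringChar K ∣ f.factorial) (hcharl : ¬ ringChar K ∣ l)
    (hGal : Nonempty ((CyclotomicField l K ≃ₐ[K] CyclotomicField l K) ≃* (ZMod l)ˣ))
    (γ : (ZMod l)ˣ) (hγ : Subgroup.zpowers γ = ⊤) :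
    (∀ m : ℕ, 1 ≤ m → m ≤ e - 1 →
      (JacobiForms.h l K e f γ m).IsHomogeneous f ∧ JacobiForms.h l K e f γ m ≠ 0) ∧
    IsIrreducible (JacobiForms.variety l K e f γ) ∧
    IsIrreducible (JacobiForms.variety l (AlgebraicClosure K) e f γ) ∧
    topologicalKrullDim (JacobiForms.variety l K e f γ) = ((l - e : ℕ) : WithBot ℕ∞) ∧
    JacobiForms.IsCompleteIntersection (JacobiForms.variety l K e f γ)
      (JacobiForms.hFamily l K e f γ) := by
  have hlK : (l : K) ≠ 0 := fun h0 => hcharl (ringChar.dvd h0)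
  have hlE : (l : AlgebraicClosure K) ≠ 0 := by
    rw [← map_natCast (algebraMap K (AlgebraicClosure K))]
    exact (map_ne_zero _).2 hlK
  have hf0 : f ≠ 0 := by omega
  have he : e ≠ 0 := by
    rintro rfl
    exact (Fact.out : l.Prime).one_lt.ne' (by rw [hlef, zero_mul])
  have hdim := JacobiForms.ringKrullDim_quotient_span_hFamily hlK hf0 hlef hγ
  rw [← JacobiForms.topologicalKrullDim_zeroLocus] at hdim
  refine ⟨fun m hm hme => ⟨JacobiForms.isHomogeneous_h m,
      JacobiForms.h_ne_zero hlK hf0 hlef hγ hm hme⟩,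
    JacobiForms.isIrreducible_variety hlK hf0 hlef hγ,
    JacobiForms.isIrreducible_variety hlE hf0 hlef hγ, ?_, rfl, ?_, ?_⟩
  · rw [JacobiForms.variety, JacobiForms.natCast_eq_of_add_eq hdim]
    rw [show l - 1 - (e - 1) = l - e by omega]
  · rw [JacobiForms.variety, ← PrimeSpectrum.zeroLocus_span,
      PrimeSpectrum.vanishingIdeal_zeroLocus_eq_radical]
    exact (JacobiForms.isPrime_and_le_height hlK hf0 hlef hγ).1.isRadical.radical
  · rw [JacobiForms.card_idx]
    exact hdim
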